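/- The base field is $\mathbb C$. Let $a,b\in\mathbb Z_{\ge 0}\cup\{\infty\}$ and let $I$ be the set of nonzero integers $i$ with $-b\le i\le a$. Let $A$ be either the Weyl superalgebra $D(a|b)$ or the Clifford superalgebra $Cl(a|b)$. Here $D(a|b)$ is the associative superalgebra with generators $x_i,\partial_i$ ($i\in I$), even for $i>0$ and odd for $i<0$, and relations $[x_i,x_j]=[\partial_i,\partial_j]=0$, $[\partial_i,x_j]=\delta_{ij}$, where $[u,v]=uv-(-1)^{\bar u\bar v}vu$; and $Cl(a|b)$ is the associative superalgebra with generators $\xi_i,\eta_i$ ($i\in I$), even for $i>0$ and odd for $i<0$, and relations $\{\xi_i,\xi_j\}=\{\eta_i,\eta_j\}=0$, $\{\eta_i,\xi_j\}=\delta_{ij}$, where $\{u,v\}=uv+(-1)^{\bar u\bar v}vu$. Put $u_i=x_i\partial_i$ (respectively $u_i=\xi_i\eta_i$). A weight of $A$ is a family $\mu=(\mu_i)_{i\in I}$ of complex numbers with $\mu_i\in\{0,1\}$ for all $i<0$ if $A=D(a|b)$, and for all $i>0$ if $A=Cl(a|b)$. For an $A$-module ($\mathbb Z/2$-graded) $X$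 let $X^\mu=\{x\in X: u_ix=\mu_ix\text{ for all }i\in I\}$; $X$ is a weight module if $X=\bigoplus_\mu X^\mu$, the sum being over all weights $\mu$. Let $Q=\bigoplus_{i\in I}\mathbb Z\zeta_i$, where $\zeta_i$ is the $i$-th coordinate vector, and let $p:Q\to\mathbb Z/2$ be the homomorphism with $p(\zeta_i)=0$ for $i>0$ and $p(\zeta_i)=1$ for $i<0$. Fix an extension of $p$ to the set of weights such that $p(\mu+\alpha)=p(\mu)+p(\alpha)$ whenever $\alpha\in Q$ and $\mu$, $\mu+\alpha$ are weights. A weight module $X$ is preferred if every nonzero weight space $X^\mu$ is purely even when $p(\mu)=0$ and purely odd when $p(\mu)=1$. **Theorem.** Let $X$ be an indecomposable (in particular nonzero) preferred weight $A$-module all of whose weight spaces $X^\mu$ are finite-dimensional. Then there are an interval $R$ in $\mathbb Z$ and $A$-submodules (graded) $X_n\subseteq X$, $n\in R$, such that $X_n\subsetneq X_m$ for all $n<m$ in $R$, $\bigcup_{n\in R}X_n=X$, $\bigcap_{n\in R}X_n=\{0\}$, and $X_n/X_{n-1}$ is a simple $A$-module whenever $n,n-1\in R$. -/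

import Mathlib

namespace CliffordWeyl

/-- The two families of superalgebras: Weyl superalgebras `D(a|b)` and Clifford superalgebras
`Cl(a|b)`. -/
inductive Family
  | weyl
  | clifford

/-- The index set `{1, …, a} ∪ {-1, …, -b}`, where `a` and `b` may be infinite. -/
def Index (a b : ℕ∞) : Type :=
  {i : ℤ // (0 < i ∧ (i.natAbs : ℕ∞) ≤ a) ∨ (i < 0 ∧ (i.natAbs : ℕ∞) ≤ b)}

/-- The parity attached to an index: `0` for `i > 0` and `1` for `i < 0`. -/
def Index.parity {a b : ℕ∞} (i : Index a b) : ZMod 2 := if 0 < i.1 then 0 else 1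

/-- The generators: `raise i` is `x_i` (respectively `ξ_i`), and `lower i` is
`∂_i` (respectively `η_i`). -/
inductive Gen (a b : ℕ∞) : Type
  | raise (i : Index a b)
  | lower (i : Index a b)

def Gen.parity {a b : ℕ∞} : Gen a b → ZMod 2
  | .raise i => i.parity
  | .lower i => i.parity

/-- The bracket of two generators in the free algebra: `uv - (-1)^(|u||v|) vu` in the Weyl case and
`uv + (-1)^(|u||v|) vu` in the Clifford case. -/
noncomputable def freeBracket {a b : ℕ∞} (t : Family) (u v : Gen a b) : FreeAlgebra ℂ (Gen a b) :=
  match t with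
  | .weyl => FreeAlgebra.ι ℂ u * FreeAlgebra.ι ℂ v
      - ((-1 : ℂ) ^ (u.parity.val * v.parity.val)) • (FreeAlgebra.ι ℂ v * FreeAlgebra.ι ℂ u)
  | .clifford => FreeAlgebra.ι ℂ u * FreeAlgebra.ι ℂ v
      + ((-1 : ℂ) ^ (u.parity.val * v.parity.val)) • (FreeAlgebra.ι ℂ v * FreeAlgebra.ι ℂ u)

/-- The defining relations of `D(a|b)` and `Cl(a|b)`. -/
inductive Rel (t : Family) (a b : ℕ∞) :
    FreeAlgebra ℂ (Gen a b) → FreeAlgebra ℂ (Gen a b) → Prop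
  | raise_raise (i j : Index a b) : Rel t a b (freeBracket t (.raise i) (.raise j)) 0
  | lower_lower (i j : Index a b) : Rel t a b (freeBracket t (.lower i) (.lower j)) 0
  | lower_raise_self (i : Index a b) : Rel t a b (freeBracket t (.lower i) (.raise i)) 1
  | lower_raise_ne (i j : Index a b) (h : i ≠ j) :
      Rel t a b (freeBracket t (.lower i) (.raise j)) 0

/-- The associative algebra underlying `D(a|b)` (for `t = weyl`) or `Cl(a|b)`
(for `t = clifford`). -/
def Alg (t : Family) (a b : ℕ∞) : Type := RingQuot (Rel t a b)

noncomputable instance (t : Family) (a b : ℕ∞) : Ring (Alg t a b) :=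
  inferInstanceAs (Ring (RingQuot (Rel t a b)))

noncomputable instance (t : Family) (a b : ℕ∞) : Algebra ℂ (Alg t a b) :=
  inferInstanceAs (Algebra ℂ (RingQuot (Rel t a b)))

section

variable (t : Family) {a b : ℕ∞}

/-- A generator, as an element of `D(a|b)` or `Cl(a|b)`. -/
noncomputable def gen (g : Gen a b) : Alg t a b :=
  RingQuot.mkAlgHom ℂ (Rel t a b) (FreeAlgebra.ι ℂ g)

/-- The `ℤ/2`-grading of `D(a|b)` or `Cl(a|b)`: the part of parity `j` is spanned by the products
of generators whose parities add up to `j`. -/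
noncomputable def algParity (a b : ℕ∞) (j : ZMod 2) : Submodule ℂ (Alg t a b) :=
  Submodule.span ℂ
    {y | ∃ w : List (Gen a b), (w.map Gen.parity).sum = j ∧ (w.map (gen t)).prod = y}

/-- `u_i = x_i ∂_i` (respectively `ξ_i η_i`). -/
noncomputable def cartan (i : Index a b) : Alg t a b := gen t (.raise i) * gen t (.lower i)

/-- The indices at which the coordinates of a weight must be `0` or `1`. -/
def IsRestricted (i : Index a b) : Prop :=
  match t with
  | .weyl => i.1 < 0
  | .clifford => 0 < i.1

/-- The set of weights of `D(a|b)` or `Cl(a|b)`; the linear functional `μ` on the span of the `u_i`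
is given by its values `μ i = μ(u_i)`. -/
def Weight (a b : ℕ∞) : Type :=
  {μ : Index a b → ℂ // ∀ i, IsRestricted t i → μ i = 0 ∨ μ i = 1}

/-- The root lattice, the free abelian group on the `ζ_i`. -/
abbrev RootLattice (a b : ℕ∞) : Type := Index a b →₀ ℤ

/-- The parity homomorphism on the root lattice: `ζ_i ↦ 0` for `i > 0`, `ζ_i ↦ 1` for `i < 0`. -/
def rootParity (α : RootLattice a b) : ZMod 2 := α.sum fun i n => (n : ZMod 2) * i.parity

/-- `p` is an extension of the parity function from the root lattice to the set of weights:
it agrees with it on the weights lying in the root lattice, and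
`p(μ + α) = p(μ) + p(α)` whenever `μ` and `μ + α` are weights and `α` is in the root lattice. -/
structure IsParityExtension (p : Weight t a b → ZMod 2) : Prop where
  eq_rootParity : ∀ (μ : Weight t a b) (α : RootLattice a b),
    (∀ i, μ.1 i = (α i : ℂ)) → p μ = rootParity α
  add_root : ∀ (μ ν : Weight t a b) (α : RootLattice a b),
    (∀ i, ν.1 i = μ.1 i + (α i : ℂ)) → p ν = p μ + rootParity α

end

section

variable {t : Family} {a b : ℕ∞}
variable {X : Type*} [AddCommGroup X] [Module ℂ X] [Module (Alg t a b) X]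
  [IsScalarTower ℂ (Alg t a b) X]

/-- `X`, with even part `𝒳 0` and odd part `𝒳 1`, is a (`ℤ/2`-graded) module over the
superalgebra. -/
structure IsSupermodule (𝒳 : ZMod 2 → Submodule ℂ X) : Prop where
  isInternal : DirectSum.IsInternal 𝒳
  smul_mem : ∀ (i j : ZMod 2) (c : Alg t a b) (x : X),
    c ∈ algParity t a b i → x ∈ 𝒳 j → c • x ∈ 𝒳 (i + j)

/-- A submodule is graded if it is the sum of its even and odd parts. -/
def IsGradedSubmodule (𝒳 : ZMod 2 → Submodule ℂ X) (N : Submodule (Alg t a b) X) : Prop :=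
  ⨆ j, (N.restrictScalars ℂ ⊓ 𝒳 j) = N.restrictScalars ℂ

/-- Simplicity in the category of supermodules: `X` is nonzero and has no graded submodules other
than `0` and `X`. -/
def IsSimpleSupermodule (𝒳 : ZMod 2 → Submodule ℂ X) : Prop :=
  Nontrivial X ∧
    ∀ N : Submodule (Alg t a b) X, IsGradedSubmodule 𝒳 N → N = ⊥ ∨ N = ⊤

/-- Indecomposability in the category of supermodules: `X` is nonzero and is not the direct sum of
two nonzero graded submodules. -/
def IsIndecomposableSupermodule (𝒳 : ZMod 2 → Submodule ℂ X) : Prop :=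
  Nontrivial X ∧
    ∀ N M : Submodule (Alg t a b) X, IsGradedSubmodule 𝒳 N → IsGradedSubmodule 𝒳 M →
      IsCompl N M → N = ⊥ ∨ M = ⊥

/-- The grading induced on the subquotient `N / (M ∩ N)`; it is used for `M ≤ N`. -/
noncomputable def subquotientGrading (𝒳 : ZMod 2 → Submodule ℂ X) (M N : Submodule (Alg t a b) X)
    (j : ZMod 2) : Submodule ℂ (N ⧸ M.submoduleOf N) :=
  ((𝒳 j).comap (N.subtype.restrictScalars ℂ)).map
    ((M.submoduleOf N).mkQ.restrictScalars ℂ)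

variable (X) in
/-- The weight space `X^μ`. -/
def weightSpace (μ : Weight t a b) : Submodule ℂ X where
  carrier := {x | ∀ i, cartan t i • x = μ.1 i • x}
  zero_mem' := by intro i; simp
  add_mem' := by
    intro x y hx hy i
    rw [smul_add, smul_add, hx i, hy i]
  smul_mem' := by
    intro c x hx i
    rw [← algebraMap_smul (Alg t a b) c x, smul_smul, ← Algebra.commutes, ← smul_smul, hx i,
      algebraMap_smul, algebraMap_smul, smul_comm]

open Classical in
variable (t a b X) in
/-- `X` is a weight module: it is the direct sum of the weight spaces `X^μ`, where `μ` runs over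
the weights of the superalgebra. -/
def IsWeightModule : Prop :=
  DirectSum.IsInternal (fun μ : Weight t a b => weightSpace X μ)

/-- `X` is a preferred weight module with respect to `p`: each weight space `X^μ` is
purely of parity `p(μ)`. -/
def IsPreferred (p : Weight t a b → ZMod 2) (𝒳 : ZMod 2 → Submodule ℂ X) : Prop :=
  IsWeightModule t a b X ∧ ∀ μ : Weight t a b, weightSpace X μ ≤ 𝒳 (p μ)

end

end CliffordWeyl

/-! In a preferred module every submodule is the sum of its weight components, hence graded, so the
ordinary submodule lattice suffices. Indecomposability puts all weights into one coset of the root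
lattice, based at some `e` (`exists_sameCoset`). At each unrestricted index a wall separates the
nonnegative integer values of that coordinate from all others. A weight of the coset is separated
from `e` by finitely many walls, and weights separated from `e` by the same walls have weight spaces
identified by mutually inverse algebra elements (`linked_of_sameCoset`).

There may be infinitely many walls, so X need not have finite length. Number the walls. Call a
weight near if it has crossed only walls numbered below n, and far otherwise. At near weights
`upperSubmodule` is everything and `lowerSubmodule` is zero; at far weights both consist of the
vectors that cannot be carried back across the last wall crossed. As n grows, the upper submodules
exhaust X and the lower ones shrink to zero. A submodule between them is determined by its
intersections with one weight space for each set of walls numbered below n, so finite-dimensionality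
bounds the length (`wallRank_strictMonoOn`). A maximal chain through all these submodules, cut down
to the intervals between them, is locally finite and hence indexed by an interval of integers
(`exists_int_chain`). -/

namespace CliffordWeyl

/-! ### Locally finite chains and integer indexing -/

section OrderTheory

open Order

/-- The numbering `toZ` of a linear order by integers has an interval as its range. -/
theorem ordConnected_range_toZ {ι : Type*} [LinearOrder ι] [SuccOrder ι] [IsSuccArchimedean ι]
    [PredOrder ι] (i₀ : ι) : (Set.range (toZ i₀)).OrdConnected := by
  refine ⟨?_⟩
  rintro _ ⟨i, rfl⟩ _ ⟨j, rfl⟩ m ⟨him, hmj⟩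
  rcases le_or_gt 0 m with hm | hm
  · obtain ⟨k, rfl⟩ := Int.eq_ofNat_of_zero_le hm
    refine ⟨succ^[k] i₀, ?_⟩
    -- If the iterated successor has already stopped at a maximum, its number is still `k`, because
    -- `k` is at most the number of `j`.
    by_cases h : IsMax (succ^[k] i₀)
    · exact le_antisymm (toZ_iterate_succ_le k) (hmj.trans (toZ_strictMono.monotone (h.isTop j)))
    · exact toZ_iterate_succ_of_not_isMax k h
  · obtain ⟨k, rfl⟩ := Int.eq_ofNat_of_zero_le (neg_nonneg.2 hm.le) |>.imp fun _ h => neg_eq_iff_eq_neg.1 h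
    refine ⟨pred^[k] i₀, ?_⟩
    by_cases h : IsMin (pred^[k] i₀)
    · exact le_antisymm ((toZ_strictMono.monotone (h.isBot i)).trans him) (toZ_iterate_pred_ge k)
    · exact toZ_iterate_pred_of_not_isMin k h

theorem exists_int_indexing {ι : Type*} [LinearOrder ι] [Nonempty ι]
    (h : ∀ x y : ι, (Set.Icc x y).Finite) :
    ∃ e : ι → ℤ, StrictMono e ∧ (Set.range e).OrdConnected := by
  let _ := LocallyFiniteOrder.ofFiniteIcc h
  let _ := LinearLocallyFiniteOrder.succOrder ι
  let _ := LinearLocallyFiniteOrder.predOrder ι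
  exact ⟨toZ (Classical.arbitrary ι), toZ_strictMono, ordConnected_range_toZ _⟩

/-- If the intervals `[lo n, hi n]` grow with `n` and have finite rank, then some chain indexed by
an interval of integers passes through all `lo n` and `hi n` and cannot be refined. -/
theorem exists_int_chain {L : Type*} [PartialOrder L] (lo hi : ℕ → L) (hlo : Antitone lo)
    (hhi : Monotone hi) (hle : ∀ n, lo n ≤ hi n) (d : ℕ → L → ℕ)
    (hd : ∀ n, StrictMonoOn (d n) (Set.Icc (lo n) (hi n))) :
    ∃ (R : Set ℤ) (F : ℤ → L), R.OrdConnected ∧ StrictMonoOn F R ∧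
      (∀ n ∈ R, n - 1 ∈ R → F (n - 1) ⋖ F n) ∧ (∀ k, ∃ n ∈ R, F n = lo k) ∧
      ∀ k, ∃ n ∈ R, F n = hi k := by
  classical
  have hlohi : ∀ m n, lo m ≤ hi n := fun m n => by
    rcases le_total m n with h | h
    · exact (hle m).trans (hhi h)
    · exact (hlo h).trans (hle n)
  have hchain : IsChain (· ≤ ·) (Set.range lo ∪ Set.range hi) := by
    rintro _ (⟨m, rfl⟩ | ⟨m, rfl⟩) _ (⟨n, rfl⟩ | ⟨n, rfl⟩) _
    · exact (le_total m n).symm.imp (fun h => hlo h) (fun h => hlo h)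
    · exact Or.inl (hlohi _ _)
    · exact Or.inr (hlohi _ _)
    · exact (le_total m n).imp (fun h => hhi h) (fun h => hhi h)
  obtain ⟨M, hM, hsub⟩ := hchain.exists_maxChain
  -- `M` may also contain elements below every `lo n` or above every `hi n`, such as a bottom or
  -- top; dropping them makes the chain locally finite.
  let C : Set L := {x | x ∈ M ∧ ∃ n, x ∈ Set.Icc (lo n) (hi n)}
  have hCM : C ⊆ M := fun x hx => hx.1
  have hC : IsChain (· ≤ ·) C := hM.1.mono hCM
  have hloC : ∀ k, lo k ∈ C := fun k => ⟨hsub (Or.inl ⟨k, rfl⟩), k, le_rfl, hle k⟩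
  have hhiC : ∀ k, hi k ∈ C := fun k => ⟨hsub (Or.inr ⟨k, rfl⟩), k, hle k, le_rfl⟩
  let _ : LinearOrder C := hC.linearOrder
  have : Nonempty C := ⟨⟨lo 0, hloC 0⟩⟩
  have hbetween : ∀ x y : C, ∃ n, lo n ≤ x ∧ (y : L) ≤ hi n := by
    rintro ⟨x, _, m, hm⟩ ⟨y, _, n, hn⟩
    exact ⟨max m n, (hlo (le_max_left m n)).trans hm.1, hn.2.trans (hhi (le_max_right m n))⟩
  have hfin : ∀ x y : C, (Set.Icc x y).Finite := by
    intro x y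
    obtain ⟨n, hx, hy⟩ := hbetween x y
    have hmem : ∀ z ∈ Set.Icc x y, (z : L) ∈ Set.Icc (lo n) (hi n) := fun z hz =>
      ⟨hx.trans hz.1, le_trans (b := (y : L)) hz.2 hy⟩
    refine Set.Finite.of_finite_image (f := fun z : C => d n z) ?_ ?_
    · refine (Set.finite_Iic (d n (hi n))).subset ?_
      rintro _ ⟨z, hz, rfl⟩
      exact (hd n).monotoneOn (hmem z hz) ⟨hle n, le_rfl⟩ (hmem z hz).2
    · intro z hz w hw hzw
      rcases lt_trichotomy z w with h | h | h
      · exact absurd hzw (hd n (hmem z hz) (hmem w hw) h).ne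
      · exact h
      · exact absurd hzw (hd n (hmem w hw) (hmem z hz) h).ne'
  obtain ⟨e, he, hR⟩ := exists_int_indexing hfin
  have hF : ∀ c : C, ((Function.invFun e (e c) : C) : L) = c := fun c => by
    rw [Function.leftInverse_invFun he.injective c]
  refine ⟨Set.range e, fun n => (Function.invFun e n : C), hR, ?_, ?_, ?_, ?_⟩
  · rintro _ ⟨x, rfl⟩ _ ⟨y, rfl⟩ hxy
    simp only [hF]
    exact he.lt_iff_lt.1 hxy
  · rintro _ ⟨y, rfl⟩ ⟨x, hx⟩
    rw [← hx]
    simp only [hF]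
    have hxy : x < y := he.lt_iff_lt.1 (by omega)
    refine ⟨hxy, fun z hxz hzy => ?_⟩
    -- By maximality it is enough that `z` is comparable with all of `M`. Members of `C` lie on one
    -- side of the consecutive pair `x`, `y`; the others lie outside an interval `[lo n, hi n]`
    -- containing that pair.
    have hzM : z ∈ M := by
      have hins : IsChain (· ≤ ·) (insert z M) := by
        refine hM.1.insert fun w hw _ => ?_
        by_cases hwC : w ∈ C
        · rcases le_or_gt (⟨w, hwC⟩ : C) x with h | h
          · exact Or.inr (le_trans (b := (x : L)) h hxz.le)
          · have : y ≤ (⟨w, hwC⟩ : C) := by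
              have := he h
              exact he.le_iff_le.1 (by omega)
            exact Or.inl (hzy.le.trans this)
        · obtain ⟨n, hxn, hyn⟩ := hbetween x y
          have h1 : lo n ≤ w ∨ w ≤ lo n := hM.1.total (hloC n).1 hw
          have h2 : w ≤ hi n ∨ hi n ≤ w := hM.1.total hw (hhiC n).1
          rcases h1 with h1 | h1
          · rcases h2 with h2 | h2
            · exact absurd ⟨hw, n, h1, h2⟩ hwC
            · exact Or.inl ((hzy.le.trans hyn).trans h2)
          · exact Or.inr ((h1.trans hxn).trans hxz.le)
      rw [hM.2 hins (Set.subset_insert z M)]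
      exact Set.mem_insert z M
    obtain ⟨n, hxn, hyn⟩ := hbetween x y
    have hzC : z ∈ C := ⟨hzM, n, hxn.trans hxz.le, hzy.le.trans hyn⟩
    have h1 := he (show x < ⟨z, hzC⟩ from hxz)
    have h2 := he (show (⟨z, hzC⟩ : C) < y from hzy)
    omega
  · exact fun k => ⟨_, ⟨⟨lo k, hloC k⟩, rfl⟩, hF _⟩
  · exact fun k => ⟨_, ⟨⟨hi k, hhiC k⟩, rfl⟩, hF _⟩

end OrderTheory

/-! ### Commutation relations of the generators -/

section Relations

variable (t : Family) {a b : ℕ∞}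

noncomputable instance : DecidableEq (Index a b) := Classical.decEq _

/-- The projection of the free algebra onto `D(a|b)` or `Cl(a|b)`. -/
noncomputable def freeProj (a b : ℕ∞) : FreeAlgebra ℂ (Gen a b) →ₐ[ℂ] Alg t a b :=
  RingQuot.mkAlgHom ℂ (Rel t a b)

theorem freeProj_surjective : Function.Surjective (freeProj t a b) :=
  RingQuot.mkAlgHom_surjective ℂ (Rel t a b)

theorem freeProj_rel {u v : FreeAlgebra ℂ (Gen a b)} (h : Rel t a b u v) :
    freeProj t a b u = freeProj t a b v :=
  RingQuot.mkAlgHom_rel ℂ h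

theorem freeProj_ι (g : Gen a b) : freeProj t a b (FreeAlgebra.ι ℂ g) = gen t g := rfl

/-- The sign with which two generators commute. -/
noncomputable def commSign (g h : Gen a b) : ℂ :=
  match t with
  | .weyl => (-1) ^ (g.parity.val * h.parity.val)
  | .clifford => -(-1) ^ (g.parity.val * h.parity.val)

theorem commSign_mul_self (g h : Gen a b) : commSign t g h * commSign t g h = 1 := by
  cases t <;> simp [commSign, ← mul_pow]

theorem freeProj_freeBracket (g h : Gen a b) : freeProj t a b (freeBracket t g h) =
    gen t g * gen t h - commSign t g h • (gen t h * gen t g) := by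
  cases t <;> simp [freeBracket, commSign, freeProj_ι]

theorem raise_mul_raise (i j : Index a b) : gen t (.raise i) * gen t (.raise j) =
    commSign t (.raise i) (.raise j) • (gen t (.raise j) * gen t (.raise i)) := by
  have h := freeProj_rel t (Rel.raise_raise (t := t) i j)
  rwa [freeProj_freeBracket, map_zero, sub_eq_zero] at h

theorem lower_mul_lower (i j : Index a b) : gen t (.lower i) * gen t (.lower j) =
    commSign t (.lower i) (.lower j) • (gen t (.lower j) * gen t (.lower i)) := by
  have h := freeProj_rel t (Rel.lower_lower (t := t) i j)
  rwa [freeProj_freeBracket, map_zero, sub_eq_zero] at h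

theorem lower_mul_raise_of_ne {i j : Index a b} (hij : i ≠ j) :
    gen t (.lower i) * gen t (.raise j) =
    commSign t (.lower i) (.raise j) • (gen t (.raise j) * gen t (.lower i)) := by
  have h := freeProj_rel t (Rel.lower_raise_ne (t := t) i j hij)
  rwa [freeProj_freeBracket, map_zero, sub_eq_zero] at h

theorem raise_mul_lower_of_ne {i j : Index a b} (hij : i ≠ j) :
    gen t (.raise i) * gen t (.lower j) =
    commSign t (.lower j) (.raise i) • (gen t (.lower j) * gen t (.raise i)) := by
  rw [lower_mul_raise_of_ne t hij.symm, smul_smul, commSign_mul_self, one_smul]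

theorem lower_mul_raise_self (i : Index a b) : gen t (.lower i) * gen t (.raise i) =
    commSign t (.lower i) (.raise i) • cartan t i + 1 := by
  have h := freeProj_rel t (Rel.lower_raise_self (t := t) i)
  rwa [freeProj_freeBracket, map_one, sub_eq_iff_eq_add, add_comm] at h

theorem parity_of_isRestricted {i : Index a b} (hi : IsRestricted t i) :
    i.parity = match t with | .weyl => 1 | .clifford => 0 := by
  cases t <;> simp only [IsRestricted] at hi
  · simp [Index.parity, hi.le]
  · simp [Index.parity, hi]

theorem parity_of_not_isRestricted {i : Index a b} (hi : ¬ IsRestricted t i) :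
    i.parity = match t with | .weyl => 0 | .clifford => 1 := by
  cases t <;> simp only [IsRestricted] at hi
  · have := i.2
    simp only [Index.parity]
    rw [if_pos (by omega)]
  · simp [Index.parity, not_lt.1 hi]

theorem commSign_self_of_isRestricted {i : Index a b} (hi : IsRestricted t i) {g h : Gen a b}
    (hg : g.parity = i.parity) (hh : h.parity = i.parity) : commSign t g h = -1 := by
  rw [parity_of_isRestricted t hi] at hg hh
  cases t <;> simp [commSign, hg, hh, ZMod.val_one]

theorem commSign_self_of_not_isRestricted {i : Index a b} (hi : ¬ IsRestricted t i)
    {g h : Gen a b} (hg : g.parity = i.parity) (hh : h.parity = i.parity) :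
    commSign t g h = 1 := by
  rw [parity_of_not_isRestricted t hi] at hg hh
  cases t <;> simp [commSign, hg, hh, ZMod.val_one]

variable {t}

theorem raise_mul_self_of_isRestricted {i : Index a b} (hi : IsRestricted t i) :
    gen t (.raise i) * gen t (.raise i) = 0 := by
  have h := raise_mul_raise t i i
  rw [commSign_self_of_isRestricted t hi rfl rfl, neg_one_smul, eq_neg_iff_add_eq_zero,
    ← two_smul ℂ] at h
  exact (smul_eq_zero_iff_right two_ne_zero).1 h

theorem lower_mul_self_of_isRestricted {i : Index a b} (hi : IsRestricted t i) :
    gen t (.lower i) * gen t (.lower i) = 0 := by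
  have h := lower_mul_lower t i i
  rw [commSign_self_of_isRestricted t hi rfl rfl, neg_one_smul, eq_neg_iff_add_eq_zero,
    ← two_smul ℂ] at h
  exact (smul_eq_zero_iff_right two_ne_zero).1 h

theorem lower_mul_raise_of_isRestricted {i : Index a b} (hi : IsRestricted t i) :
    gen t (.lower i) * gen t (.raise i) = 1 - cartan t i := by
  rw [lower_mul_raise_self, commSign_self_of_isRestricted t hi rfl rfl]
  simp [sub_eq_neg_add]

theorem lower_mul_raise_of_not_isRestricted {i : Index a b} (hi : ¬ IsRestricted t i) :
    gen t (.lower i) * gen t (.raise i) = cartan t i + 1 := by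
  rw [lower_mul_raise_self, commSign_self_of_not_isRestricted t hi rfl rfl, one_smul]

/-- The effect of a generator on weights. -/
noncomputable def Gen.shift : Gen a b → Index a b → ℂ
  | .raise i => Pi.single i 1
  | .lower i => Pi.single i (-1)

theorem cartan_mul_raise_self (i : Index a b) :
    cartan t i * gen t (.raise i) = gen t (.raise i) * cartan t i + gen t (.raise i) := by
  by_cases hi : IsRestricted t i
  · have h : gen t (.raise i) * cartan t i = 0 := by
      rw [cartan, ← mul_assoc, raise_mul_self_of_isRestricted hi, zero_mul]
    nth_rw 1 [cartan]
    rw [mul_assoc, lower_mul_raise_of_isRestricted hi, mul_sub, h, mul_one, sub_zero, zero_add]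
  · rw [cartan, mul_assoc, lower_mul_raise_of_not_isRestricted hi, mul_add, mul_one, cartan]

theorem cartan_mul_lower_self (i : Index a b) :
    cartan t i * gen t (.lower i) = gen t (.lower i) * cartan t i - gen t (.lower i) := by
  by_cases hi : IsRestricted t i
  · have h : cartan t i * gen t (.lower i) = 0 := by
      rw [cartan, mul_assoc, lower_mul_self_of_isRestricted hi, mul_zero]
    rw [h, cartan, ← mul_assoc, lower_mul_raise_of_isRestricted hi, sub_mul, h]
    simp
  · nth_rw 2 [cartan]
    rw [← mul_assoc, lower_mul_raise_of_not_isRestricted hi, add_mul, one_mul, add_sub_cancel_right]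

/-- The same sign is picked up twice, once from each factor of `cartan t i`, and cancels. -/
theorem cartan_mul_of_signs {i : Index a b} {g : Alg t a b} {s : ℂ} (hs : s * s = 1)
    (h₁ : gen t (.raise i) * g = s • (g * gen t (.raise i)))
    (h₂ : gen t (.lower i) * g = s • (g * gen t (.lower i))) :
    cartan t i * g = g * cartan t i := by
  rw [cartan, mul_assoc, h₂, mul_smul_comm, ← mul_assoc, h₁, smul_mul_assoc, smul_smul, hs,
    one_smul, mul_assoc]

theorem commSign_comm (g h : Gen a b) : commSign t g h = commSign t h g := by
  cases t <;> simp [commSign, mul_comm]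

theorem cartan_mul_gen (j : Index a b) (g : Gen a b) :
    cartan t j * gen t g = gen t g * cartan t j + g.shift j • gen t g := by
  rcases g with i | i <;> rcases eq_or_ne j i with rfl | hij
  · simp [Gen.shift, cartan_mul_raise_self]
  · rw [Gen.shift, Pi.single_eq_of_ne hij, zero_smul, add_zero]
    exact cartan_mul_of_signs (commSign_mul_self t (.raise j) (.raise i)) (raise_mul_raise t j i)
      (lower_mul_raise_of_ne t hij)
  · simp [Gen.shift, cartan_mul_lower_self, sub_eq_add_neg]
  · rw [Gen.shift, Pi.single_eq_of_ne hij, zero_smul, add_zero]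
    exact cartan_mul_of_signs (commSign_mul_self t (.lower i) (.raise j))
      (raise_mul_lower_of_ne t hij)
      ((lower_mul_lower t j i).trans (by rw [commSign_comm]; rfl))

/-- Any two generators commute up to a scalar factor and a scalar summand. -/
theorem exists_gen_mul_gen (g h : Gen a b) :
    ∃ s c : ℂ, gen t g * gen t h = s • (gen t h * gen t g) + c • 1 := by
  rcases g with i | i <;> rcases h with j | j
  · exact ⟨commSign t (.raise i) (.raise j), 0, by
      rw [zero_smul, add_zero]; exact raise_mul_raise t i j⟩
  · rcases eq_or_ne i j with rfl | hij
    · refine ⟨commSign t (.lower i) (.raise i), -commSign t (.lower i) (.raise i), ?_⟩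
      rw [lower_mul_raise_self, smul_add, smul_smul, commSign_mul_self]
      simp [cartan]
    · exact ⟨commSign t (.lower j) (.raise i), 0, by
        rw [zero_smul, add_zero]; exact raise_mul_lower_of_ne t hij⟩
  · rcases eq_or_ne i j with rfl | hij
    · exact ⟨commSign t (.lower i) (.raise i), 1, by
        rw [one_smul]; exact lower_mul_raise_self t i⟩
    · exact ⟨commSign t (.lower i) (.raise j), 0, by
      rw [zero_smul, add_zero]; exact lower_mul_raise_of_ne t hij⟩
  · exact ⟨commSign t (.lower i) (.lower j), 0, by
      rw [zero_smul, add_zero]; exact lower_mul_lower t i j⟩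

/-- Moving a generator past a power costs at most one factor of the power; this makes
`nilpotentPart` a submodule. -/
theorem exists_gen_pow_mul_gen (g h : Gen a b) (k : ℕ) : ∃ s c : ℂ,
    gen t g ^ (k + 1) * gen t h = s • (gen t h * gen t g ^ (k + 1)) + c • gen t g ^ k := by
  obtain ⟨s, c, hsc⟩ := exists_gen_mul_gen (t := t) g h
  induction k with
  | zero => exact ⟨s, c, by simpa using hsc⟩
  | succ k ih =>
    obtain ⟨s', c', ih⟩ := ih
    refine ⟨s' * s, s' * c + c', ?_⟩
    rw [pow_succ' _ (k + 1), mul_assoc, ih, mul_add, mul_smul_comm, ← mul_assoc, hsc, add_mul,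
      smul_mul_assoc, smul_mul_assoc, one_mul, mul_assoc, ← pow_succ', mul_smul_comm, ← pow_succ',
      smul_add, smul_smul, smul_smul, add_smul, add_assoc]

end Relations

/-! ### Joint eigenspaces and nilpotent parts -/

section Modules

variable {t : Family} {a b : ℕ∞}
variable {X : Type*} [AddCommGroup X] [Module ℂ X] [Module (Alg t a b) X]
  [IsScalarTower ℂ (Alg t a b) X]

/-- A subspace stable under the generators is a submodule. -/
def submoduleOfStable (P : Submodule ℂ X) (h : ∀ (g : Gen a b), ∀ x ∈ P, gen t g • x ∈ P) :
    Submodule (Alg t a b) X where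
  __ := P.toAddSubmonoid
  smul_mem' := by
    intro c x hx
    obtain ⟨c, rfl⟩ := freeProj_surjective t c
    change freeProj t a b c • x ∈ P
    replace hx : x ∈ P := hx
    induction c generalizing x with
    | grade0 r => simpa [algebraMap_smul] using P.smul_mem r hx
    | grade1 g => exact h g x hx
    | mul u v hu hv =>
      rw [map_mul, mul_smul]
      exact hu (hv hx)
    | add u v hu hv =>
      rw [map_add, add_smul]
      exact P.add_mem (hu hx) (hv hx)

instance : SMulCommClass ℂ (Alg t a b) X where
  smul_comm c u x := by
    rw [← algebraMap_smul (Alg t a b) c x, ← algebraMap_smul (Alg t a b) c (u • x), smul_smul,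
      smul_smul, Algebra.commutes]

variable (t X) in
/-- The vectors killed by a power of a generator. -/
def nilpotentPart (g : Gen a b) : Submodule (Alg t a b) X :=
  submoduleOfStable
    { carrier := {x | ∃ k : ℕ, gen t g ^ k • x = 0}
      zero_mem' := ⟨0, by simp⟩
      add_mem' := by
        rintro x y ⟨k, hk⟩ ⟨l, hl⟩
        refine ⟨k + l, ?_⟩
        rw [smul_add, pow_add, mul_smul _ _ y, hl, (Commute.pow_pow_self (gen t g) k l).eq,
          mul_smul, hk]
        simp
      smul_mem' := by
        rintro c x ⟨k, hk⟩
        exact ⟨k, by rw [smul_comm, hk, smul_zero]⟩ }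
    (by
      rintro h x ⟨k, hk⟩
      obtain ⟨s, c, hsc⟩ := exists_gen_pow_mul_gen (t := t) g h k
      refine ⟨k + 1, ?_⟩
      rw [smul_smul, hsc, add_smul, smul_assoc, smul_assoc, mul_smul, pow_succ', mul_smul, hk]
      simp)

theorem mem_nilpotentPart {g : Gen a b} {x : X} :
    x ∈ nilpotentPart t X g ↔ ∃ k : ℕ, gen t g ^ k • x = 0 := Iff.rfl

variable (t X) in
/-- The joint eigenspace of the `u_i` for an arbitrary family of eigenvalues. -/
def jointEigenspace (f : Index a b → ℂ) : Submodule ℂ X where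
  carrier := {x | ∀ i, cartan t i • x = f i • x}
  zero_mem' := by intro i; simp
  add_mem' := by
    intro x y hx hy i
    rw [smul_add, smul_add, hx i, hy i]
  smul_mem' := by
    intro c x hx i
    rw [smul_comm, hx i, smul_comm]

theorem gen_smul_mem {f : Index a b → ℂ} {x : X} (hx : x ∈ jointEigenspace t X f) (g : Gen a b) :
    gen t g • x ∈ jointEigenspace t X (f + g.shift) := by
  intro i
  rw [smul_smul, cartan_mul_gen, add_smul, mul_smul, hx i, smul_assoc, smul_comm, ← add_smul]
  rfl

theorem raise_lower_smul {f : Index a b → ℂ} {x : X} (hx : x ∈ jointEigenspace t X f)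
    (i : Index a b) : gen t (.raise i) • gen t (.lower i) • x = f i • x := by
  rw [smul_smul]
  exact hx i

theorem lower_raise_smul_of_not_isRestricted {f : Index a b → ℂ} {x : X}
    (hx : x ∈ jointEigenspace t X f) {i : Index a b} (hi : ¬ IsRestricted t i) :
    gen t (.lower i) • gen t (.raise i) • x = (f i + 1) • x := by
  rw [smul_smul, lower_mul_raise_of_not_isRestricted hi, add_smul, hx i, one_smul, add_smul,
    one_smul]

theorem lower_raise_smul_of_isRestricted {f : Index a b → ℂ} {x : X}
    (hx : x ∈ jointEigenspace t X f) {i : Index a b} (hi : IsRestricted t i) :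
    gen t (.lower i) • gen t (.raise i) • x = (1 - f i) • x := by
  rw [smul_smul, lower_mul_raise_of_isRestricted hi, sub_smul, hx i, one_smul, sub_smul,
    one_smul]

/-- If the sum of vectors of distinct weights lies in a submodule, so does each of them. -/
theorem mem_of_sum_mem (N : Submodule (Alg t a b) X) (s : Finset (Index a b → ℂ))
    (x : (Index a b → ℂ) → X) (hx : ∀ f ∈ s, x f ∈ jointEigenspace t X f)
    (hN : ∑ f ∈ s, x f ∈ N) : ∀ f ∈ s, x f ∈ N := by
  classical
  induction s using Finset.induction_on generalizing x with
  | empty => simp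
  | insert e s hes ih =>
    have hs : ∀ f ∈ s, x f ∈ N := by
      intro f hf
      obtain ⟨i, hi⟩ : ∃ i, f i ≠ e i := Function.ne_iff.1 (ne_of_mem_of_not_mem hf hes)
      -- Applying `u_i - e i` kills the component at `e` and rescales the others, which reduces to
      -- the smaller set.
      have key : ∀ f ∈ s, (f i - e i) • x f ∈ N := by
        refine ih (fun f => (f i - e i) • x f)
          (fun f hf => Submodule.smul_mem _ _ (hx f (Finset.mem_insert_of_mem hf))) ?_
        have h := N.smul_mem (cartan t i - algebraMap ℂ _ (e i)) hN
        rw [Finset.smul_sum, Finset.sum_insert hes] at h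
        convert h using 1
        rw [sub_smul, algebraMap_smul, hx e (Finset.mem_insert_self _ _) i, sub_self, zero_add]
        refine Finset.sum_congr rfl fun f hf => ?_
        rw [sub_smul, sub_smul, algebraMap_smul, hx f (Finset.mem_insert_of_mem hf) i]
      have h := N.smul_mem (algebraMap ℂ (Alg t a b) (f i - e i)⁻¹) (key f hf)
      rwa [algebraMap_smul, inv_smul_smul₀ (sub_ne_zero.2 hi)] at h
    intro f hf
    rcases Finset.mem_insert.1 hf with rfl | hf
    · rw [Finset.sum_insert hes] at hN
      exact (N.add_mem_iff_left (N.sum_mem hs)).1 hN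
    · exact hs f hf

end Modules

/-! ### Submodules built from weight spaces -/

section WeightModules

variable {t : Family} {a b : ℕ∞}
variable {X : Type*} [AddCommGroup X] [Module ℂ X] [Module (Alg t a b) X]
  [IsScalarTower ℂ (Alg t a b) X]

theorem exists_finset_sum_of_mem_iSup {ι R M : Type*} [Semiring R] [AddCommMonoid M] [Module R M]
    {P : ι → Submodule R M} {x : M} (hx : x ∈ ⨆ i, P i) :
    ∃ (s : Finset ι) (y : ι → M), (∀ i, y i ∈ P i) ∧ ∑ i ∈ s, y i = x := by
  obtain ⟨y, hy, rfl⟩ := (Submodule.mem_iSup_iff_exists_finsupp P x).1 hx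
  exact ⟨y.support, y, hy, rfl⟩

/-- Evaluating raise-lower-raise on `x` in two ways gives `(1 - f i)` and `(f i + 1)` times the
raised vector. For `f i ≠ 0` that vector vanishes, and lowering it again gives `(1 - f i) • x = 0`.
-/
theorem eq_zero_of_not_isWeight {f : Index a b → ℂ} {x : X} (hx : x ∈ jointEigenspace t X f)
    {i : Index a b} (hi : IsRestricted t i) (h0 : f i ≠ 0) (h1 : f i ≠ 1) : x = 0 := by
  have h := raise_lower_smul (gen_smul_mem hx (.raise i)) i
  rw [lower_raise_smul_of_isRestricted hx hi, smul_comm, ← sub_eq_zero, ← sub_smul] at h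
  have h2 : gen t (.raise i) • x = 0 := by
    refine (smul_eq_zero_iff_right ?_).1 h
    simp only [Pi.add_apply, Gen.shift, Pi.single_eq_same]
    intro h
    exact h0 (by linear_combination (-1 / 2 : ℂ) * h)
  have h3 := lower_raise_smul_of_isRestricted hx hi
  rw [h2, smul_zero] at h3
  exact (smul_eq_zero_iff_right (sub_ne_zero.2 h1.symm)).1 h3.symm

theorem iSup_jointEigenspace (hX : IsWeightModule t a b X) :
    ⨆ f : Index a b → ℂ, jointEigenspace t X f = ⊤ := by
  classical
  refine top_unique ?_
  rw [← DirectSum.IsInternal.submodule_iSup_eq_top hX]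
  exact iSup_le fun μ => le_iSup (jointEigenspace t X) μ.1

theorem le_of_forall_jointEigenspace (hX : ⨆ f : Index a b → ℂ, jointEigenspace t X f = ⊤)
    {N N' : Submodule (Alg t a b) X} (h : ∀ f : Index a b → ℂ, ∀ x ∈ jointEigenspace t X f, x ∈ N → x ∈ N') :
    N ≤ N' := by
  intro x hx
  obtain ⟨s, y, hy, rfl⟩ := exists_finset_sum_of_mem_iSup (hX ▸ Submodule.mem_top (x := x))
  exact N'.sum_mem fun f hf => h f _ (hy f) (mem_of_sum_mem N s y (fun f _ => hy f) hx f hf)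

/-- The submodule which is the sum of a family of subspaces of the weight spaces. -/
def familySubmodule (P : (Index a b → ℂ) → Submodule ℂ X)
    (hP : ∀ f, ∀ x ∈ P f, ∀ g : Gen a b, gen t g • x ∈ P (f + g.shift)) :
    Submodule (Alg t a b) X :=
  submoduleOfStable (⨆ f, P f) fun g x hx => by
    induction hx using Submodule.iSup_induction' with
    | mem f x hx => exact Submodule.mem_iSup_of_mem _ (hP f x hx g)
    | zero => simp
    | add x y _ _ hx hy =>
      rw [smul_add]
      exact add_mem hx hy

theorem mem_familySubmodule_of_mem {P : (Index a b → ℂ) → Submodule ℂ X}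
    {hP : ∀ f, ∀ x ∈ P f, ∀ g : Gen a b, gen t g • x ∈ P (f + g.shift)} {f : Index a b → ℂ}
    {x : X} (hx : x ∈ P f) : x ∈ familySubmodule P hP :=
  Submodule.mem_iSup_of_mem f hx

theorem mem_familySubmodule {P : (Index a b → ℂ) → Submodule ℂ X}
    {hP : ∀ f, ∀ x ∈ P f, ∀ g : Gen a b, gen t g • x ∈ P (f + g.shift)}
    (hle : ∀ f, P f ≤ jointEigenspace t X f) {f : Index a b → ℂ} {x : X}
    (hx : x ∈ jointEigenspace t X f) : x ∈ familySubmodule P hP ↔ x ∈ P f := by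
  classical
  refine ⟨fun h => ?_, mem_familySubmodule_of_mem⟩
  obtain ⟨s, y, hy, hsum⟩ := exists_finset_sum_of_mem_iSup (P := P) h
  -- Uniqueness of weight decompositions, applied to the difference of the given sum and `x`; `f` is
  -- inserted since it may be missing from `s`.
  have key := mem_of_sum_mem (⊥ : Submodule (Alg t a b) X) (insert f s)
    (fun e => (if e ∈ s then y e else 0) - if e = f then x else 0) (fun e _ => ?_) ?_ f
    (Finset.mem_insert_self f s)
  · rw [Submodule.mem_bot, if_pos rfl, sub_eq_zero] at key
    rw [← key]
    split_ifs
    · exact hy f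
    · exact zero_mem _
  · refine sub_mem ?_ ?_
    · split_ifs
      · exact hle e (hy e)
      · exact zero_mem _
    · split_ifs with he
      · exact he ▸ hx
      · exact zero_mem _
  · rw [Submodule.mem_bot, Finset.sum_sub_distrib, Finset.sum_ite_eq',
      if_pos (Finset.mem_insert_self f s), Finset.sum_ite_mem,
      Finset.inter_eq_right.2 (Finset.subset_insert f s), hsum, sub_self]

/-- Weight components of a vector of `N` lie in `N` and are homogeneous, so the grading imposes no
condition on submodules. -/
theorem isGradedSubmodule_of_isPreferred {p : Weight t a b → ZMod 2} {𝒳 : ZMod 2 → Submodule ℂ X}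
    (hX : IsPreferred p 𝒳) (N : Submodule (Alg t a b) X) : IsGradedSubmodule 𝒳 N := by
  refine le_antisymm (iSup_le fun j => inf_le_left) fun x hx => ?_
  obtain ⟨s, y, hy, rfl⟩ := exists_finset_sum_of_mem_iSup
    (iSup_jointEigenspace hX.1 ▸ Submodule.mem_top (x := x))
  refine Submodule.sum_mem _ fun f hf => ?_
  have hyN := mem_of_sum_mem N s y (fun f _ => hy f) hx f hf
  by_cases hw : ∀ i, IsRestricted t i → f i = 0 ∨ f i = 1
  · exact Submodule.mem_iSup_of_mem (p ⟨f, hw⟩) ⟨hyN, hX.2 ⟨f, hw⟩ (hy f)⟩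
  · push Not at hw
    obtain ⟨i, hi, h0, h1⟩ := hw
    rw [eq_zero_of_not_isWeight (hy f) hi h0 h1]
    exact zero_mem _

/-! ### Root lattice cosets and indecomposability -/

/-- Two families of eigenvalues differ by an element of the root lattice. -/
def SameCoset (e f : Index a b → ℂ) : Prop :=
  ∃ α : RootLattice a b, ∀ i, f i = e i + (α i : ℂ)

theorem SameCoset.add_shift {e f : Index a b → ℂ} (h : SameCoset e f) (g : Gen a b) :
    SameCoset e (f + g.shift) := by
  obtain ⟨α, hα⟩ := h
  rcases g with i | i
  · refine ⟨α + Finsupp.single i 1, fun j => ?_⟩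
    rcases eq_or_ne j i with rfl | hj
    · simp [Gen.shift, hα, add_assoc]
    · simp [Gen.shift, hα, hj]
  · refine ⟨α + Finsupp.single i (-1), fun j => ?_⟩
    rcases eq_or_ne j i with rfl | hj
    · simp [Gen.shift, hα, add_assoc]
    · simp [Gen.shift, hα, hj]

/-- The generator which undoes the shift of a given one. -/
def Gen.opposite : Gen a b → Gen a b
  | .raise i => .lower i
  | .lower i => .raise i

theorem Gen.shift_opposite (g : Gen a b) : g.opposite.shift = -g.shift := by
  rcases g with i | i <;> simp [Gen.opposite, Gen.shift, Pi.single_neg]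

theorem sameCoset_add_shift_iff {e f : Index a b → ℂ} (g : Gen a b) :
    SameCoset e (f + g.shift) ↔ SameCoset e f := by
  refine ⟨fun h => ?_, fun h => h.add_shift g⟩
  have h' := h.add_shift g.opposite
  rwa [Gen.shift_opposite, add_neg_cancel_right] at h'

open Classical in
/-- The sum of the weight spaces whose weights satisfy a shift-invariant condition. -/
noncomputable def blockSubmodule (t : Family) {a b : ℕ∞} (X : Type*) [AddCommGroup X] [Module ℂ X]
    [Module (Alg t a b) X] [IsScalarTower ℂ (Alg t a b) X] (S : (Index a b → ℂ) → Prop)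
    (hS : ∀ f g, S (f + Gen.shift g) ↔ S f) : Submodule (Alg t a b) X :=
  familySubmodule (fun f => if S f then jointEigenspace t X f else ⊥) fun f x hx g => by
    simp only [hS]
    split_ifs at hx ⊢
    · exact gen_smul_mem hx g
    · rw [(Submodule.mem_bot ℂ).1 hx, smul_zero]
      exact zero_mem _

theorem mem_blockSubmodule {S : (Index a b → ℂ) → Prop}
    {hS : ∀ f g, S (f + Gen.shift g) ↔ S f} {f : Index a b → ℂ} {x : X}
    (hx : x ∈ jointEigenspace t X f) : x ∈ blockSubmodule t X S hS ↔ (x ≠ 0 → S f) := by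
  classical
  rw [blockSubmodule, mem_familySubmodule _ hx]
  · split_ifs with h
    · simp [hx, h]
    · simp [h]
  · intro f
    split_ifs
    · exact le_rfl
    · exact bot_le

theorem isCompl_blockSubmodule (hX : ⨆ f : Index a b → ℂ, jointEigenspace t X f = ⊤)
    {S : (Index a b → ℂ) → Prop} (hS : ∀ f g, S (f + Gen.shift g) ↔ S f) :
    IsCompl (blockSubmodule t X S hS)
      (blockSubmodule t X (fun f => ¬ S f) fun f g => not_congr (hS f g)) := by
  constructor
  · rw [disjoint_iff]
    refine bot_unique (le_of_forall_jointEigenspace hX fun f x hx h => ?_)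
    obtain ⟨h1, h2⟩ := h
    by_contra h0
    exact (mem_blockSubmodule hx).1 h2 h0 ((mem_blockSubmodule hx).1 h1 h0)
  · rw [codisjoint_iff]
    refine top_unique (le_of_forall_jointEigenspace hX fun f x hx _ => ?_)
    by_cases h : S f
    · exact Submodule.mem_sup_left ((mem_blockSubmodule hx).2 fun _ => h)
    · exact Submodule.mem_sup_right ((mem_blockSubmodule hx).2 fun _ => h)

/-- The weights of an indecomposable module lie in one coset of the root lattice. -/
theorem exists_sameCoset {p : Weight t a b → ZMod 2} {𝒳 : ZMod 2 → Submodule ℂ X}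
    (hX : IsPreferred p 𝒳) (hind : IsIndecomposableSupermodule (t := t) (a := a) (b := b) 𝒳) :
    ∃ e : Weight t a b, ∀ f : Index a b → ℂ, ∀ x ∈ jointEigenspace t X f, x ≠ 0 → SameCoset e.1 f := by
  have htop := iSup_jointEigenspace hX.1
  obtain ⟨f, x, hx, hx0⟩ : ∃ f, ∃ x ∈ jointEigenspace t X f, x ≠ 0 := by
    by_contra! h
    have := hind.1
    refine bot_ne_top (α := Submodule ℂ X) ?_
    rw [← htop, eq_comm, iSup_eq_bot]
    exact fun f => (Submodule.eq_bot_iff _).2 (h f)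
  have hf : ∀ i, IsRestricted t i → f i = 0 ∨ f i = 1 := fun i hi => by
    by_contra! h
    exact hx0 (eq_zero_of_not_isWeight hx hi h.1 h.2)
  have hS : ∀ e g, SameCoset f (e + Gen.shift g) ↔ SameCoset f e :=
    fun e g => sameCoset_add_shift_iff g
  have hself : SameCoset f f := ⟨0, by simp⟩
  refine ⟨⟨f, hf⟩, fun e y hy hy0 => ?_⟩
  rcases hind.2 _ _ (isGradedSubmodule_of_isPreferred hX _)
    (isGradedSubmodule_of_isPreferred hX _) (isCompl_blockSubmodule htop hS) with h | h
  · refine absurd ?_ hx0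
    rw [← Submodule.mem_bot (Alg t a b), ← h]
    exact (mem_blockSubmodule hx).2 fun _ => hself
  · by_contra hne
    refine absurd ?_ hy0
    rw [← Submodule.mem_bot (Alg t a b), ← h]
    exact (mem_blockSubmodule hy).2 fun _ => hne

end WeightModules

/-! ### Identifying weight spaces on the same side of every wall -/

section Walls

variable {t : Family} {a b : ℕ∞}
variable {X : Type*} [AddCommGroup X] [Module ℂ X] [Module (Alg t a b) X]
  [IsScalarTower ℂ (Alg t a b) X]

variable (t X) in
/-- Two weight spaces are carried to each other by mutually inverse elements of the algebra. -/
def Linked (e f : Index a b → ℂ) : Prop :=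
  ∃ u v : Alg t a b, (∀ x ∈ jointEigenspace t X e, u • x ∈ jointEigenspace t X f ∧ v • u • x = x) ∧
    ∀ x ∈ jointEigenspace t X f, v • x ∈ jointEigenspace t X e ∧ u • v • x = x

theorem Linked.refl (e : Index a b → ℂ) : Linked t X e e :=
  ⟨1, 1, fun x hx => by simpa using hx, fun x hx => by simpa using hx⟩

theorem Linked.symm {e f : Index a b → ℂ} (h : Linked t X e f) : Linked t X f e := by
  obtain ⟨u, v, hu, hv⟩ := h
  exact ⟨v, u, hv, hu⟩

theorem Linked.trans {e f g : Index a b → ℂ} (h : Linked t X e f) (h' : Linked t X f g) :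
    Linked t X e g := by
  obtain ⟨u, v, hu, hv⟩ := h
  obtain ⟨u', v', hu', hv'⟩ := h'
  refine ⟨u' * u, v * v', fun x hx => ?_, fun x hx => ?_⟩
  · simp only [mul_smul]
    refine ⟨(hu' _ (hu x hx).1).1, ?_⟩
    rw [(hu' _ (hu x hx).1).2, (hu x hx).2]
  · simp only [mul_smul]
    refine ⟨(hv _ (hv' x hx).1).1, ?_⟩
    rw [(hv _ (hv' x hx).1).2, (hv' x hx).2]

/-- Lowering after raising is the scalar `f i + 1` (equal to 1 in the restricted case), so a raising
step is invertible unless it goes from -1 to 0. -/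
theorem linked_raise {f : Index a b → ℂ} {i : Index a b} (h0 : IsRestricted t i → f i = 0)
    (h1 : ¬ IsRestricted t i → f i ≠ -1) : Linked t X f (f + Gen.shift (.raise i)) := by
  have hne : f i + 1 ≠ 0 := by
    by_cases hi : IsRestricted t i
    · simp [h0 hi]
    · exact fun h => h1 hi (eq_neg_of_add_eq_zero_left h)
  refine ⟨gen t (.raise i), (f i + 1)⁻¹ • gen t (.lower i), fun x hx => ⟨gen_smul_mem hx _, ?_⟩,
    fun x hx => ⟨?_, ?_⟩⟩
  · have h : gen t (.lower i) • gen t (.raise i) • x = (f i + 1) • x := by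
      by_cases hi : IsRestricted t i
      · rw [lower_raise_smul_of_isRestricted hx hi, h0 hi]
        simp
      · exact lower_raise_smul_of_not_isRestricted hx hi
    rw [smul_assoc, h, inv_smul_smul₀ hne]
  · have h := gen_smul_mem hx (.lower i)
    rw [← Gen.opposite, Gen.shift_opposite, add_neg_cancel_right] at h
    rw [smul_assoc]
    exact Submodule.smul_mem _ _ h
  · rw [smul_assoc, smul_comm, raise_lower_smul hx]
    simp only [Pi.add_apply, Gen.shift, Pi.single_eq_same]
    rw [inv_smul_smul₀ hne]

theorem linked_update_add_nat (e : Index a b → ℂ) (i : Index a b) (k : ℕ)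
    (h0 : ∀ m < k, IsRestricted t i → e i + m = 0)
    (h1 : ∀ m < k, ¬ IsRestricted t i → e i + m ≠ -1) :
    Linked t X e (Function.update e i (e i + k)) := by
  induction k with
  | zero => simpa using Linked.refl e
  | succ k ih =>
    refine (ih (fun m hm => h0 m (by omega)) fun m hm => h1 m (by omega)).trans ?_
    convert linked_raise (t := t) (X := X) (f := Function.update e i (e i + k)) (i := i) ?_ ?_
      using 1
    · ext j
      rcases eq_or_ne j i with rfl | hj
      · simp [Gen.shift, add_assoc]
      · simp [Gen.shift, hj]
    · simpa using h0 k (by omega)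
    · simpa using h1 k (by omega)

/-- The coordinate `f i` is a nonnegative integer. -/
def IsNatAt (f : Index a b → ℂ) (i : Index a b) : Prop := ∃ k : ℕ, f i = k

theorem linked_update_of_eq_add {e : Index a b → ℂ} {i : Index a b} {c : ℂ} (k : ℕ)
    (hc : c = e i + k)
    (h0 : IsRestricted t i → (e i = 0 ∨ e i = 1) ∧ (c = 0 ∨ c = 1))
    (h1 : ¬ IsRestricted t i → ((∃ m : ℕ, c = m) → IsNatAt e i)) :
    Linked t X e (Function.update e i c) := by
  subst hc
  refine linked_update_add_nat e i k (fun m hm hi => ?_) fun m hm hi h => ?_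
  · obtain ⟨h | h, h'⟩ := h0 hi <;> rw [h] at h' ⊢
    · have : k = 0 ∨ k = 1 := by simpa using h'
      obtain rfl : m = 0 := by omega
      simp
    · exfalso
      have : (1 + k = 0) ∨ 1 + k = 1 := by exact_mod_cast h'
      omega
  -- Meeting -1 after `m` steps would make the endpoint the natural number `k - m - 1`; then `e i`
  -- would be natural too, and `e i + m` could not be -1.
  · obtain ⟨n, hn⟩ := h1 hi ⟨k - m - 1, by
      rw [Nat.cast_sub (by omega), Nat.cast_sub hm.le]
      push_cast
      linear_combination h⟩
    rw [hn] at h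
    have : ((n + m + 1 : ℕ) : ℂ) = 0 := by
      push_cast
      linear_combination h
    exact absurd (Nat.cast_eq_zero.1 this) (by omega)

theorem linked_update {e : Index a b → ℂ} {i : Index a b} {c : ℂ} (k : ℤ) (hc : c = e i + k)
    (h0 : IsRestricted t i → (e i = 0 ∨ e i = 1) ∧ (c = 0 ∨ c = 1))
    (h1 : ¬ IsRestricted t i → ((∃ m : ℕ, c = m) ↔ IsNatAt e i)) :
    Linked t X e (Function.update e i c) := by
  rcases Int.eq_nat_or_neg k with ⟨n, rfl | rfl⟩
  · exact linked_update_of_eq_add n (by simpa using hc) h0 fun hi => (h1 hi).1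
  · have h := linked_update_of_eq_add (t := t) (X := X) (e := Function.update e i c) (i := i)
      (c := e i) n (by simp [hc]) (fun hi => by simpa using (h0 hi).symm)
      (fun hi => by simpa [IsNatAt] using (h1 hi).2)
    rw [Function.update_idem, Function.update_eq_self] at h
    exact h.symm

/-- The weights differ in finitely many coordinates; these are changed one at a time, none crossing
its wall. -/
theorem linked_of_sameCoset {e f : Index a b → ℂ} (h : SameCoset e f)
    (he : ∀ i, IsRestricted t i → e i = 0 ∨ e i = 1)
    (hf : ∀ i, IsRestricted t i → f i = 0 ∨ f i = 1)
    (hpos : ∀ i, ¬ IsRestricted t i → (IsNatAt f i ↔ IsNatAt e i)) : Linked t X e f := by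
  obtain ⟨α, hα⟩ := h
  have key : ∀ s : Finset (Index a b), Linked t X e (fun i => if i ∈ s then f i else e i) := by
    intro s
    induction s using Finset.induction_on with
    | empty => simpa using Linked.refl e
    | insert i s his ih =>
      refine ih.trans ?_
      convert linked_update (t := t) (X := X) (e := fun i => if i ∈ s then f i else e i) (i := i)
        (c := f i) (α i) ?_ ?_ ?_ using 1
      · ext j
        rcases eq_or_ne j i with rfl | hj
        · simp
        · simp [hj]
      · simpa [his] using hα i
      · simpa [his] using fun hi => ⟨he i hi, hf i hi⟩
      · simpa [his, IsNatAt] using hpos i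
  convert key α.support using 1
  ext i
  split_ifs with hi
  · rfl
  · simpa [Finsupp.notMem_support_iff.1 hi] using hα i

/-! ### Crossing walls -/

variable (t) in
/-- The weight `f` lies on the other side of the `i`-th wall than the base point `e`. -/
def Crossed (e f : Index a b → ℂ) (i : Index a b) : Prop :=
  ¬ IsRestricted t i ∧ ¬ (IsNatAt f i ↔ IsNatAt e i)

open Classical in
/-- The generator which leads from the side of the base point `e` away from the `i`-th wall. -/
noncomputable def outwardGen (e : Index a b → ℂ) (i : Index a b) : Gen a b :=
  if IsNatAt e i then .raise i else .lower i

theorem outwardGen_of_isNatAt {e : Index a b → ℂ} {i : Index a b} (h : IsNatAt e i) :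
    outwardGen e i = .raise i := if_pos h

theorem outwardGen_of_not_isNatAt {e : Index a b → ℂ} {i : Index a b} (h : ¬ IsNatAt e i) :
    outwardGen e i = .lower i := if_neg h

variable (t X) in
/-- The vectors which cannot be carried back across the `i`-th wall. -/
noncomputable def wallKernel (e : Index a b → ℂ) (i : Index a b) : Submodule (Alg t a b) X :=
  nilpotentPart t X (outwardGen e i)

/-- On the side of the base point the outward generator is injective at every step: the opposite
generator undoes it up to a nonzero scalar. -/
theorem eq_zero_of_mem_wallKernel {e f : Index a b → ℂ} {i : Index a b} (hi : ¬ IsRestricted t i)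
    (hc : ¬ Crossed t e f i) {x : X} (hx : x ∈ jointEigenspace t X f)
    (hk : x ∈ wallKernel t X e i) : x = 0 := by
  have hpos : IsNatAt f i ↔ IsNatAt e i := by
    by_contra h
    exact hc ⟨hi, h⟩
  rw [wallKernel, mem_nilpotentPart] at hk
  obtain ⟨k, hk⟩ := hk
  clear hc
  by_cases he : IsNatAt e i
  · replace hpos := hpos.2 he
    rw [outwardGen_of_isNatAt he] at hk
    induction k generalizing f x with
    | zero => simpa using hk
    | succ k ih =>
      obtain ⟨m, hm⟩ := hpos
      rw [pow_succ, mul_smul] at hk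
      have h := ih (gen_smul_mem hx (.raise i)) hk ⟨m + 1, by simp [Gen.shift, hm]⟩
      have h' := lower_raise_smul_of_not_isRestricted hx hi
      rw [h, smul_zero, hm] at h'
      exact (smul_eq_zero_iff_right (Nat.cast_add_one_ne_zero m)).1 h'.symm
  · replace hpos : ¬ IsNatAt f i := fun h => he (hpos.1 h)
    rw [outwardGen_of_not_isNatAt he] at hk
    induction k generalizing f x with
    | zero => simpa using hk
    | succ k ih =>
      rw [pow_succ, mul_smul] at hk
      have h := ih (gen_smul_mem hx (.lower i)) hk fun ⟨m, hm⟩ => hpos ⟨m + 1, by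
        simp only [Pi.add_apply, Gen.shift, Pi.single_eq_same] at hm
        push_cast
        linear_combination hm⟩
      have h' := raise_lower_smul hx i
      rw [h, smul_zero] at h'
      exact (smul_eq_zero_iff_right fun h0 => hpos ⟨0, by simp [h0]⟩).1 h'.symm

/-- The index of a generator. -/
def Gen.index : Gen a b → Index a b
  | .raise i => i
  | .lower i => i

theorem crossed_add_shift_of_ne {e f : Index a b → ℂ} {i : Index a b} {g : Gen a b}
    (h : i ≠ g.index) : Crossed t e (f + g.shift) i ↔ Crossed t e f i := by
  have : (f + g.shift) i = f i := by
    rcases g with j | j <;> simp_all [Gen.shift, Gen.index]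
  simp only [Crossed, IsNatAt, this]

/-- A crossing goes between -1 and 0. The outward generator is then opposite to `g`, and their
product acts on `x` by 0. -/
theorem gen_smul_mem_wallKernel {e f : Index a b → ℂ} {g : Gen a b} {x : X}
    (hx : x ∈ jointEigenspace t X f) (hc : ¬ Crossed t e f g.index)
    (hc' : Crossed t e (f + g.shift) g.index) : gen t g • x ∈ wallKernel t X e g.index := by
  obtain ⟨hi, hne⟩ := hc'
  have hpos : IsNatAt f g.index ↔ IsNatAt e g.index := by
    by_contra h
    exact hc ⟨hi, h⟩
  rw [wallKernel, mem_nilpotentPart]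
  refine ⟨1, ?_⟩
  rw [pow_one]
  rw [← hpos] at hne
  rcases g with i | i
  · change ¬ IsRestricted t i at hi
    change IsNatAt f i ↔ IsNatAt e i at hpos
    change gen t (outwardGen e i) • gen t (.raise i) • x = 0
    simp only [Gen.index, IsNatAt, Gen.shift, Pi.add_apply, Pi.single_eq_same] at hne
    by_cases hf : IsNatAt f i
    · obtain ⟨k, hk⟩ := hf
      exact absurd (iff_of_true ⟨k + 1, by simp [hk]⟩ ⟨k, hk⟩) hne
    · rw [outwardGen_of_not_isNatAt (mt hpos.2 hf), lower_raise_smul_of_not_isRestricted hx hi]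
      obtain ⟨k, hk⟩ : ∃ k : ℕ, f i + 1 = k := by
        by_contra h
        exact hne (iff_of_false h hf)
      rcases k with - | k
      · rw [hk, Nat.cast_zero, zero_smul]
      · exact absurd ⟨k, by push_cast at hk; exact add_right_cancel hk⟩ hf
  · change IsNatAt f i ↔ IsNatAt e i at hpos
    change gen t (outwardGen e i) • gen t (.lower i) • x = 0
    simp only [Gen.index, IsNatAt, Gen.shift, Pi.add_apply, Pi.single_eq_same] at hne
    by_cases hf : IsNatAt f i
    · rw [outwardGen_of_isNatAt (hpos.1 hf), raise_lower_smul hx]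
      obtain ⟨k, hk⟩ := hf
      rcases k with - | k
      · rw [hk, Nat.cast_zero, zero_smul]
      · exact absurd (iff_of_true ⟨k, by simp [hk]⟩ ⟨k + 1, hk⟩) hne
    · refine absurd (iff_of_false ?_ hf) hne
      rintro ⟨k, hk⟩
      exact hf ⟨k + 1, by push_cast; linear_combination hk⟩

/-! ### The upper and lower filtrations -/

/-- A numbering of the indices. -/
def Index.code (i : Index a b) : ℕ := Encodable.encode i.1

theorem Index.code_injective : Function.Injective (Index.code (a := a) (b := b)) :=
  fun _ _ h => Subtype.ext (Encodable.encode_injective h)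

theorem finite_code_lt (n : ℕ) : {i : Index a b | i.code < n}.Finite :=
  (Set.finite_Iio n).preimage Index.code_injective.injOn

variable (t) in
/-- The `i`-th wall is the last one separating `f` from `e`. -/
def IsLastCrossed (e f : Index a b → ℂ) (i : Index a b) : Prop :=
  Crossed t e f i ∧ ∀ j, Crossed t e f j → j.code ≤ i.code

variable (t X) in
/-- The vectors of weight `f` which, if the last wall crossed has code at least `n`, cannot be
carried back across it. -/
noncomputable def upperSpace (e : Index a b → ℂ) (n : ℕ) (f : Index a b → ℂ) : Submodule ℂ X :=
  jointEigenspace t X f ⊓ ⨅ (i) (_ : IsLastCrossed t e f i) (_ : n ≤ i.code),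
    (wallKernel t X e i).restrictScalars ℂ

theorem mem_upperSpace {e f : Index a b → ℂ} {n : ℕ} {x : X} : x ∈ upperSpace t X e n f ↔
    x ∈ jointEigenspace t X f ∧
      ∀ i, IsLastCrossed t e f i → n ≤ i.code → x ∈ wallKernel t X e i := by
  simp [upperSpace]

variable (t X) in
open Classical in
/-- The vectors in `upperSpace 0` if a wall with code at least `n` is crossed, and `0` otherwise. -/
noncomputable def lowerSpace (e : Index a b → ℂ) (n : ℕ) (f : Index a b → ℂ) : Submodule ℂ X :=
  if ∀ i, Crossed t e f i → i.code < n then ⊥ else upperSpace t X e 0 f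

theorem mem_lowerSpace {e f : Index a b → ℂ} {n : ℕ} {x : X} : x ∈ lowerSpace t X e n f ↔
    x ∈ upperSpace t X e 0 f ∧ ((∀ i, Crossed t e f i → i.code < n) → x = 0) := by
  unfold lowerSpace
  split_ifs with h
  · rw [Submodule.mem_bot]
    constructor
    · rintro rfl
      exact ⟨zero_mem _, fun _ => rfl⟩
    · exact fun hx => hx.2 h
  · simp [h]

theorem gen_smul_eq_zero_of_uncross {e f : Index a b → ℂ} {g : Gen a b} {x : X}
    (hx : x ∈ jointEigenspace t X f) (hc : Crossed t e f g.index)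
    (hc' : ¬ Crossed t e (f + g.shift) g.index) (hk : x ∈ wallKernel t X e g.index) :
    gen t g • x = 0 :=
  eq_zero_of_mem_wallKernel hc.1 hc' (gen_smul_mem hx g) (Submodule.smul_mem _ _ hk)

/-- Only a change of last wall matters. If `g` uncrosses the old last wall and the new one has code
at least `n`, the result is zero; if `g` crosses a new last wall, the image lies in its kernel by
`gen_smul_mem_wallKernel`. -/
theorem gen_smul_mem_upperSpace {e f : Index a b → ℂ} {n : ℕ} {x : X}
    (hx : x ∈ upperSpace t X e n f) (g : Gen a b) :
    gen t g • x ∈ upperSpace t X e n (f + g.shift) := by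
  rw [mem_upperSpace] at hx ⊢
  refine ⟨gen_smul_mem hx.1 g, fun i hi hn => ?_⟩
  by_cases hif : IsLastCrossed t e f i
  · exact Submodule.smul_mem _ _ (hx.2 i hif hn)
  by_cases hc : Crossed t e f g.index
  · by_cases hcf : Crossed t e f i
    · obtain ⟨k, hk, hik⟩ : ∃ k, Crossed t e f k ∧ i.code < k.code := by
        by_contra! h
        exact hif ⟨hcf, h⟩
      have hkg : k = g.index := by
        by_contra hne
        exact (hi.2 k ((crossed_add_shift_of_ne hne).2 hk)).not_gt hik
      subst hkg
      have hc' : ¬ Crossed t e (f + g.shift) g.index := fun h => (hi.2 _ h).not_gt hik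
      rw [gen_smul_eq_zero_of_uncross hx.1 hc hc' (hx.2 _ ⟨hc, fun j hj => ?_⟩ (hn.trans hik.le))]
      · exact zero_mem _
      · by_cases hjg : j = g.index
        · rw [hjg]
        · exact (hi.2 j ((crossed_add_shift_of_ne hjg).2 hj)).trans hik.le
    · have hne : i ≠ g.index := fun h => hcf (h ▸ hc)
      exact absurd ((crossed_add_shift_of_ne hne).1 hi.1) hcf
  · by_cases hig : i = g.index
    · subst hig
      exact gen_smul_mem_wallKernel hx.1 hc hi.1
    · refine absurd ⟨(crossed_add_shift_of_ne hig).1 hi.1, fun j hj => ?_⟩ hif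
      exact hi.2 j ((crossed_add_shift_of_ne fun h => hc (by rwa [← h])).2 hj)

/-- To bring all crossed walls below `n`, `g` must uncross the only one with code at least `n`. That
one is the last, so `g` kills `x`. -/
theorem gen_smul_mem_lowerSpace {e f : Index a b → ℂ} {n : ℕ} {x : X}
    (hx : x ∈ lowerSpace t X e n f) (g : Gen a b) :
    gen t g • x ∈ lowerSpace t X e n (f + g.shift) := by
  rw [mem_lowerSpace] at hx ⊢
  refine ⟨gen_smul_mem_upperSpace hx.1 g, fun h => ?_⟩
  by_cases hf : ∀ i, Crossed t e f i → i.code < n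
  · rw [hx.2 hf, smul_zero]
  · push Not at hf
    obtain ⟨k, hk, hnk⟩ := hf
    have hkg : k = g.index := by
      by_contra hne
      exact (h k ((crossed_add_shift_of_ne hne).2 hk)).not_ge hnk
    subst hkg
    have hx' := mem_upperSpace.1 hx.1
    refine gen_smul_eq_zero_of_uncross hx'.1 hk (fun hc => (h _ hc).not_ge hnk)
      (hx'.2 _ ⟨hk, fun j hj => ?_⟩ (Nat.zero_le _))
    by_cases hjg : j = g.index
    · rw [hjg]
    · exact (h j ((crossed_add_shift_of_ne hjg).2 hj)).le.trans hnk

variable (t X) in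
/-- The submodule with weight components `upperSpace`. -/
noncomputable def upperSubmodule (e : Index a b → ℂ) (n : ℕ) : Submodule (Alg t a b) X :=
  familySubmodule (upperSpace t X e n) fun _ _ hx g => gen_smul_mem_upperSpace hx g

variable (t X) in
/-- The submodule with weight components `lowerSpace`. -/
noncomputable def lowerSubmodule (e : Index a b → ℂ) (n : ℕ) : Submodule (Alg t a b) X :=
  familySubmodule (lowerSpace t X e n) fun _ _ hx g => gen_smul_mem_lowerSpace hx g

theorem mem_upperSubmodule {e f : Index a b → ℂ} {n : ℕ} {x : X}
    (hx : x ∈ jointEigenspace t X f) : x ∈ upperSubmodule t X e n ↔ x ∈ upperSpace t X e n f :=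
  mem_familySubmodule (fun _ => inf_le_left) hx

theorem mem_lowerSubmodule {e f : Index a b → ℂ} {n : ℕ} {x : X}
    (hx : x ∈ jointEigenspace t X f) : x ∈ lowerSubmodule t X e n ↔ x ∈ lowerSpace t X e n f :=
  mem_familySubmodule (fun _ _ h => (mem_lowerSpace.1 h).1.1) hx

theorem familySubmodule_mono {P Q : (Index a b → ℂ) → Submodule ℂ X}
    {hP : ∀ f, ∀ x ∈ P f, ∀ g : Gen a b, gen t g • x ∈ P (f + g.shift)}
    {hQ : ∀ f, ∀ x ∈ Q f, ∀ g : Gen a b, gen t g • x ∈ Q (f + g.shift)} (h : ∀ f, P f ≤ Q f) :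
    familySubmodule P hP ≤ familySubmodule Q hQ :=
  fun _ hx => iSup_mono h hx

theorem upperSubmodule_monotone (e : Index a b → ℂ) : Monotone (upperSubmodule t X e) := by
  intro m n hmn
  refine familySubmodule_mono fun f x hx => ?_
  rw [mem_upperSpace] at hx ⊢
  exact ⟨hx.1, fun i hi hn => hx.2 i hi (hmn.trans hn)⟩

theorem lowerSubmodule_antitone (e : Index a b → ℂ) : Antitone (lowerSubmodule t X e) := by
  intro m n hmn
  refine familySubmodule_mono fun f x hx => ?_
  rw [mem_lowerSpace] at hx ⊢
  exact ⟨hx.1, fun h => hx.2 fun i hi => (h i hi).trans_le hmn⟩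

theorem lowerSubmodule_le_upperSubmodule (e : Index a b → ℂ) (n : ℕ) :
    lowerSubmodule t X e n ≤ upperSubmodule t X e n := by
  refine (familySubmodule_mono fun f x hx => ?_).trans (upperSubmodule_monotone e (Nat.zero_le n))
  exact (mem_lowerSpace.1 hx).1

theorem SameCoset.exists_code_lt {e f : Index a b → ℂ} (h : SameCoset e f) :
    ∃ n, ∀ i, Crossed t e f i → i.code < n := by
  obtain ⟨α, hα⟩ := h
  refine ⟨α.support.sup Index.code + 1, fun i hi => Nat.lt_succ_of_le (Finset.le_sup ?_)⟩
  by_contra h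
  refine hi.2 ?_
  have : f i = e i := by simpa [Finsupp.notMem_support_iff.1 h] using hα i
  simp only [IsNatAt, this]

theorem exists_mem_upperSubmodule (hX : ⨆ f : Index a b → ℂ, jointEigenspace t X f = ⊤)
    {e : Index a b → ℂ} (he : ∀ f : Index a b → ℂ, ∀ x ∈ jointEigenspace t X f, x ≠ 0 → SameCoset e f) (x : X) :
    ∃ n, x ∈ upperSubmodule t X e n := by
  have hx : x ∈ ⨆ f : Index a b → ℂ, jointEigenspace t X f := hX ▸ Submodule.mem_top
  induction hx using Submodule.iSup_induction' with
  | zero => exact ⟨0, zero_mem _⟩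
  | add x y _ _ hx hy =>
    obtain ⟨m, hm⟩ := hx
    obtain ⟨n, hn⟩ := hy
    exact ⟨max m n, add_mem (upperSubmodule_monotone e (le_max_left m n) hm)
      (upperSubmodule_monotone e (le_max_right m n) hn)⟩
  | mem f x hx =>
    by_cases h0 : x = 0
    · exact ⟨0, h0 ▸ zero_mem _⟩
    · obtain ⟨n, hn⟩ := (he f x hx h0).exists_code_lt (t := t)
      exact ⟨n, (mem_upperSubmodule hx).2
        (mem_upperSpace.2 ⟨hx, fun i hi hni => absurd (hn i hi.1) hni.not_gt⟩)⟩

theorem iInf_lowerSubmodule (hX : ⨆ f : Index a b → ℂ, jointEigenspace t X f = ⊤)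
    {e : Index a b → ℂ} (he : ∀ f : Index a b → ℂ, ∀ x ∈ jointEigenspace t X f, x ≠ 0 → SameCoset e f) :
    ⨅ n, lowerSubmodule t X e n = ⊥ := by
  refine bot_unique (le_of_forall_jointEigenspace hX fun f x hx h => ?_)
  by_contra h0
  obtain ⟨n, hn⟩ := (he f x hx h0).exists_code_lt (t := t)
  exact h0 ((mem_lowerSpace.1 ((mem_lowerSubmodule hx).1 ((Submodule.mem_iInf _).1 h n))).2 hn)

/-- Once a wall with code at least `n` is crossed, so is the code of the last one, and the upper and
lower conditions coincide. -/
theorem mem_lowerSubmodule_of_code_le {e f : Index a b → ℂ} {n : ℕ} {x : X}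
    (hx : x ∈ jointEigenspace t X f) (hxu : x ∈ upperSubmodule t X e n) {k : Index a b}
    (hk : Crossed t e f k) (hnk : n ≤ k.code) : x ∈ lowerSubmodule t X e n := by
  rw [mem_upperSubmodule hx, mem_upperSpace] at hxu
  rw [mem_lowerSubmodule hx, mem_lowerSpace, mem_upperSpace]
  exact ⟨⟨hx, fun i hi _ => hxu.2 i hi (hnk.trans (hi.2 k hk))⟩, fun h => absurd (h k hk) hnk.not_gt⟩

/-! ### Finite rank between the filtrations -/

open Classical in
variable (t) in
/-- A weight in the coset of `e` separated from `e` exactly by the walls in `T`, if there is one. -/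
noncomputable def wallRepresentative (e : Weight t a b) (T : Finset (Index a b)) : Weight t a b :=
  -- The default `e` is harmless: it only adds a term to `wallRank` that is monotone in the
  -- submodule.
  if h : ∃ μ : Weight t a b, SameCoset e.1 μ.1 ∧ ∀ i, Crossed t e.1 μ.1 i ↔ i ∈ T
  then h.choose else e

variable (t X) in
/-- The total dimension of the intersections of a submodule with finitely many weight spaces. -/
noncomputable def wallRank (e : Weight t a b) (n : ℕ) (N : Submodule (Alg t a b) X) : ℕ :=
  ∑ T ∈ (finite_code_lt n).toFinset.powerset,
    Module.finrank ℂ ↥(N.restrictScalars ℂ ⊓ weightSpace X (wallRepresentative t e T))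

theorem SameCoset.symm_trans {e f g : Index a b → ℂ} (h : SameCoset e f) (h' : SameCoset e g) :
    SameCoset f g := by
  obtain ⟨α, hα⟩ := h
  obtain ⟨β, hβ⟩ := h'
  refine ⟨β - α, fun i => ?_⟩
  rw [hα, hβ, Finsupp.sub_apply]
  push_cast
  ring

theorem wallRank_strictMonoOn (hX : ⨆ f : Index a b → ℂ, jointEigenspace t X f = ⊤)
    {e : Weight t a b} (he : ∀ f : Index a b → ℂ, ∀ x ∈ jointEigenspace t X f, x ≠ 0 → SameCoset e.1 f)
    (hfin : ∀ μ : Weight t a b, FiniteDimensional ℂ (weightSpace X μ)) (n : ℕ) :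
    StrictMonoOn (wallRank t X e n)
      (Set.Icc (lowerSubmodule t X e.1 n) (upperSubmodule t X e.1 n)) := by
  classical
  intro N hN N' hN' hlt
  have hle : ∀ T, N.restrictScalars ℂ ⊓ weightSpace X (wallRepresentative t e T) ≤
      N'.restrictScalars ℂ ⊓ weightSpace X (wallRepresentative t e T) :=
    fun T => inf_le_inf_right _ hlt.le
  have hfd : ∀ T, FiniteDimensional ℂ
      ↥(N'.restrictScalars ℂ ⊓ weightSpace X (wallRepresentative t e T)) := fun T =>
    have := hfin (wallRepresentative t e T)
    Submodule.finiteDimensional_of_le inf_le_right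
  refine Finset.sum_lt_sum (fun T _ => Submodule.finrank_mono (hle T)) ?_
  -- If no term grows, all intersections with representatives agree, and `N' ≤ N` follows weight by
  -- weight.
  by_contra! hge
  refine hlt.not_ge (le_of_forall_jointEigenspace hX fun f x hx hxN' => ?_)
  by_cases h0 : x = 0
  · rw [h0]
    exact zero_mem _
  by_cases hn : ∀ i, Crossed t e.1 f i → i.code < n
  · have hf : ∀ i, IsRestricted t i → f i = 0 ∨ f i = 1 := fun i hi => by
      by_contra! h
      exact h0 (eq_zero_of_not_isWeight hx hi h.1 h.2)
    have hcos := he f x hx h0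
    set T := (finite_code_lt (a := a) (b := b) n).toFinset.filter (Crossed t e.1 f) with hT
    have hmem : ∀ i, Crossed t e.1 f i ↔ i ∈ T := fun i => by
      simp only [hT, Finset.mem_filter, Set.Finite.mem_toFinset, Set.mem_ofPred_eq]
      exact ⟨fun h => ⟨hn i h, h⟩, fun h => h.2⟩
    have hex : ∃ μ : Weight t a b, SameCoset e.1 μ.1 ∧ ∀ i, Crossed t e.1 μ.1 i ↔ i ∈ T :=
      ⟨⟨f, hf⟩, hcos, hmem⟩
    have hrep : SameCoset e.1 (wallRepresentative t e T).1 ∧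
        ∀ i, Crossed t e.1 (wallRepresentative t e T).1 i ↔ i ∈ T := by
      rw [wallRepresentative, dif_pos hex]
      exact hex.choose_spec
    have heq := Submodule.eq_of_le_of_finrank_le (hle T)
      (hge T (Finset.mem_powerset.2 (Finset.filter_subset _ _)))
    -- The vector is carried by `u` to the representative weight space, where `N` and `N'` agree,
    -- and brought back by `v`.
    obtain ⟨u, v, hu, -⟩ : Linked t X f (wallRepresentative t e T).1 := by
      refine linked_of_sameCoset (hcos.symm_trans hrep.1) hf (wallRepresentative t e T).2
        fun i hi => ?_
      have h := (hrep.2 i).trans (hmem i).symm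
      simp only [Crossed, hi, not_false_eq_true, true_and, not_iff_not] at h
      tauto
    have hmemN : u • x ∈ N.restrictScalars ℂ ⊓ weightSpace X (wallRepresentative t e T) := by
      rw [heq]
      exact ⟨N'.smul_mem u hxN', (hu x hx).1⟩
    rw [← (hu x hx).2]
    exact N.smul_mem v hmemN.1
  · push Not at hn
    obtain ⟨k, hk, hnk⟩ := hn
    exact hN.1 (mem_lowerSubmodule_of_code_le hx (hN'.2 hxN') hk hnk)

/-- The quotient is simple even as an ungraded module. -/
theorem isSimpleSupermodule_of_covBy {𝒳 : ZMod 2 → Submodule ℂ X} {M N : Submodule (Alg t a b) X}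
    (h : M ⋖ N) : IsSimpleSupermodule (t := t) (a := a) (b := b) (subquotientGrading 𝒳 M N) := by
  have hs : IsSimpleModule (Alg t a b) (N ⧸ M.submoduleOf N) :=
    (covBy_iff_quot_is_simple h.le).1 h
  exact ⟨IsSimpleModule.nontrivial (Alg t a b) _, fun K _ => eq_bot_or_eq_top K⟩

end Walls

end CliffordWeyl

/-! ### Assembling the composition chain -/

theorem mainTheorem9 (t : CliffordWeyl.Family) (a b : ℕ∞)
    (p : CliffordWeyl.Weight t a b → ZMod 2) (hp : CliffordWeyl.IsParityExtension t p)
    {X : Type*} [AddCommGroup X] [Module ℂ X] [Module (CliffordWeyl.Alg t a b) X]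
    [IsScalarTower ℂ (CliffordWeyl.Alg t a b) X]
    (𝒳 : ZMod 2 → Submodule ℂ X)
    (hsuper : CliffordWeyl.IsSupermodule (t := t) (a := a) (b := b) 𝒳)
    (hpref : CliffordWeyl.IsPreferred p 𝒳)
    (hindec : CliffordWeyl.IsIndecomposableSupermodule (t := t) (a := a) (b := b) 𝒳)
    (hfin : ∀ μ : CliffordWeyl.Weight t a b,
      FiniteDimensional ℂ (CliffordWeyl.weightSpace X μ)) :
    ∃ (R : Set ℤ) (F : ℤ → Submodule (CliffordWeyl.Alg t a b) X),
      R.OrdConnected ∧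
      (∀ n ∈ R, CliffordWeyl.IsGradedSubmodule 𝒳 (F n)) ∧
      (∀ n ∈ R, ∀ m ∈ R, n < m → F n < F m) ∧
      (⋃ n ∈ R, (F n : Set X)) = Set.univ ∧
      (⋂ n ∈ R, (F n : Set X)) = {0} ∧
      (∀ n ∈ R, n - 1 ∈ R →
        CliffordWeyl.IsSimpleSupermodule (t := t) (a := a) (b := b)
          (CliffordWeyl.subquotientGrading 𝒳 (F (n - 1)) (F n))) := by
  classical
  have hX := CliffordWeyl.iSup_jointEigenspace hpref.1
  obtain ⟨e, he⟩ := CliffordWeyl.exists_sameCoset hpref hindec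
  obtain ⟨R, F, hR, hF, hcov, hlo, hhi⟩ := CliffordWeyl.exists_int_chain
    (CliffordWeyl.lowerSubmodule t X e.1) (CliffordWeyl.upperSubmodule t X e.1)
    (CliffordWeyl.lowerSubmodule_antitone e.1) (CliffordWeyl.upperSubmodule_monotone e.1)
    (CliffordWeyl.lowerSubmodule_le_upperSubmodule e.1) (CliffordWeyl.wallRank t X e)
    (CliffordWeyl.wallRank_strictMonoOn hX he hfin)
  refine ⟨R, F, hR, fun n _ => CliffordWeyl.isGradedSubmodule_of_isPreferred hpref _,
    fun n hn m hm h => hF hn hm h, ?_, ?_,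
    fun n hn hn' => CliffordWeyl.isSimpleSupermodule_of_covBy (hcov n hn hn')⟩
  · refine Set.eq_univ_of_forall fun x => ?_
    obtain ⟨k, hk⟩ := CliffordWeyl.exists_mem_upperSubmodule hX he x
    obtain ⟨n, hn, hnk⟩ := hhi k
    exact Set.mem_biUnion hn (hnk ▸ hk)
  · refine Set.Subset.antisymm (fun x hx => ?_) ?_
    · rw [Set.mem_singleton_iff, ← Submodule.mem_bot (CliffordWeyl.Alg t a b),
        ← CliffordWeyl.iInf_lowerSubmodule hX he, Submodule.mem_iInf]
      intro k
      obtain ⟨n, hn, hnk⟩ := hlo k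
      rw [← hnk]
      exact Set.mem_iInter₂.1 hx n hn
    · rintro _ rfl
      exact Set.mem_iInter₂.2 fun n _ => zero_mem (F n)
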